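/- Consider the multinomial-logit (MNL) bandit with $N=2$ items of known revenues $r_1,r_2>0$ and unknown attraction parameters $v=(v_1,v_2)$, where in each period at most one item is offered: the feasible assortments are $\mathcal S=\{\emptyset,\{1\},\{2\}\}$. When $S\in\mathcal S$ is offered, the customer buys item $i\in S$ with probability $\frac{v_i}{1+\sum_{j\in S}v_j}$ and buys nothing with probability $\frac{1}{1+\sum_{j\in S}v_j}$; the expected revenue is $R(S,v)=\sum_{i\in S}\frac{r_iv_i}{1+\sum_{j\in S}v_j}$. An admissible pair $(\pi,\widehat\Delta_v)$ for horizon $T$ consists of a policy $\pi$, which draws the assortment $S_t\in\mathcal S$ from a distribution that depends on the assortments and choices of periods $1,\dots,t-1$, and an estimator $\widehat\Delta_v$, a real-valued function of the assortments and choices of periods $1,\dots,T$. For an instance $\varphi=(v_1,v_2)$ let $$\mathrm{Reg}_\varphi(T,\pi)=\sum_{t=1}^T\max_{S\in\mathcal S}R(S,v)-\mathbb E_{\varphi,\pi}\Big[\sum_{t=1}^TR(S_t,v)\Big],\qquad e_\varphi(T,\widehat\Delta_v)=\mathbb E_{\varphi,\pi}\big[\,|\widehat\Delta_v-(v_1-v_2)|\,\big].$$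 For $0<\delta<\tfrac12$ let $\mathcal E_0=\{(v_1,v_2)\in(0,1]^2:\ |v_1-v_2|\ge\delta\}$. **Theorem.** For all $r_1,r_2>0$ and $0<\delta<\frac12$ there is a constant $c>0$, depending only on $r_1,r_2,\delta$, such that for every $T\ge1$ and every admissible pair $(\pi,\widehat\Delta_v)$ for horizon $T$ there is an instance $\varphi\in\mathcal E_0$ with $$e_\varphi(T,\widehat\Delta_v)\,\sqrt{\mathrm{Reg}_\varphi(T,\pi)}\ \ge\ c .$$ In other words, $\inf_{(\pi,\widehat\Delta_v)}\sup_{\varphi\in\mathcal E_0}\big[e_\varphi(T,\widehat\Delta_v)\sqrt{\mathrm{Reg}_\varphi(T,\pi)}\big]=\Omega(1)$. -/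

import Mathlib

namespace MNL

noncomputable section

/-- An assortment of the `N` items. -/
abbrev Assortment (N : ℕ) : Type := Finset (Fin N)

/-- What is recorded in one period: the assortment offered and the customer's choice
(`none` is the no-purchase option `0`, `some i` is the purchase of item `i`). -/
abbrev Round (N : ℕ) : Type := Assortment N × Option (Fin N)

/-- A history of `t` periods. -/
abbrev History (N t : ℕ) : Type := Fin t → Round N

/-- MNL choice probabilities, with the no-purchase attraction normalised to `v₀ = 1`. -/
def choiceProb {N : ℕ} (v : Fin N → ℝ) (S : Assortment N) : Option (Fin N) → ℝ
  | none => 1 / (1 + ∑ j ∈ S, v j)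
  | some i => if i ∈ S then v i / (1 + ∑ j ∈ S, v j) else 0

/-- Expected revenue `R(S, v)` of offering `S`, when item `i` has revenue `r i`. -/
def revenue {N : ℕ} (r v : Fin N → ℝ) (S : Assortment N) : ℝ :=
  ∑ i ∈ S, r i * v i / (1 + ∑ j ∈ S, v j)

/-- The assortments with at most `K` items. -/
def capped (N K : ℕ) : Finset (Assortment N) :=
  Finset.univ.filter fun S => S.card ≤ K

theorem capped_nonempty (N K : ℕ) : (capped N K).Nonempty :=
  ⟨∅, by simp [capped]⟩

/-- The revenue `R(S*, v)` of an optimal assortment among those with at most `K` items. -/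
def optRevenue {N : ℕ} (K : ℕ) (r v : Fin N → ℝ) : ℝ :=
  (capped N K).sup' (capped_nonempty N K) (revenue r v)

/-- A (possibly randomised) history-dependent policy that offers at most `K` items at a time:
after each history of `t` periods it draws the assortment of the next period. -/
structure Policy (N K : ℕ) where
  rule : (t : ℕ) → History N t → PMF (Assortment N)
  feasible : ∀ (t : ℕ) (h : History N t), ∀ S ∈ (rule t h).support, S ∈ capped N K

/-- The first `t` periods of a history of `T` periods. -/
def History.before {N T : ℕ} (h : History N T) (t : Fin T) : History N t :=
  fun i => h (Fin.castLE t.isLt.le i)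

/-- The probability of the history `h` when the policy `π` is run on the attraction
parameters `v`: in each period the policy draws the assortment given the past, and the customer
then chooses from it according to the MNL model. -/
def historyProb {N K T : ℕ} (π : Policy N K) (v : Fin N → ℝ) (h : History N T) : ℝ :=
  ∏ t : Fin T, (π.rule t (h.before t) (h t).1).toReal * choiceProb v (h t).1 (h t).2

/-- Expectation of a function of the history of the first `T` periods. -/
def expect {N K T : ℕ} (π : Policy N K) (v : Fin N → ℝ) (X : History N T → ℝ) : ℝ :=
  ∑ h : History N T, historyProb π v h * X h

/-- Cumulative expected regret of `π` over `T` periods. -/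
def regret {N K : ℕ} (r : Fin N → ℝ) (T : ℕ) (π : Policy N K) (v : Fin N → ℝ) : ℝ :=
  (∑ _t : Fin T, optRevenue K r v)
    - expect π v (fun h : History N T => ∑ t : Fin T, revenue r v (h t).1)

/-- An estimator computed from the history of `T` periods. -/
abbrev Estimator (N T : ℕ) : Type := History N T → ℝ

/-- Expected absolute error of an estimator of the parameter difference `v₁ - v₂`
(the two items are indexed by `0` and `1`). -/
def estError {K T : ℕ} (π : Policy 2 K) (est : Estimator 2 T) (v : Fin 2 → ℝ) : ℝ :=
  expect π v (fun h => |est h - (v 0 - v 1)|)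

/-- The two-item instances with attraction parameters in `(0, 1]` that are at least `δ` apart. -/
def instances (δ : ℝ) : Set (Fin 2 → ℝ) :=
  {v | (∀ i, 0 < v i ∧ v i ≤ 1) ∧ δ ≤ |v 0 - v 1|}

end

end MNL

namespace MNL

open Finset

variable {N K T : ℕ}

/-! Learning the attraction of an item requires offering it, and offering it is costly where it is
the worse item. Let `k` be an item of larger revenue, fix the other attraction at 1/2, and vary only
the attraction `b` of `k`. For `b` in `[β/2, β]`, with `β` small, each offer of `k` costs at least
`r i / 6`.

If for some such `b` the item is offered at most 1/2 times in expectation, then with probability at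
least 1/2 it is never offered. Such histories have the same probability for every `b`, so they also
occur at `b = 1/2 + δ` and `b = 1`, where `k` is optimal. There regret and, at one of the two, error
are bounded below (`lower_bound_of_rare_offers`).

Otherwise let `f b ≥ 1/2` be the expected number of offers. Shifting a near-minimiser `b` of `f` by
order `1/√(f b)` keeps the Kullback-Leibler divergence bounded, so the error at one of the two
points is of order `1/√(f b)`, while the regret at both is at least of order `f b`. The factors
cancel (`lower_bound_of_frequent_offers`). -/

/-! ### Choice probabilities. -/

theorem choiceProb_nonneg {v : Fin N → ℝ} (hv : ∀ i, 0 ≤ v i) (S : Assortment N)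
    (c : Option (Fin N)) : 0 ≤ choiceProb v S c := by
  have hS : 0 ≤ ∑ j ∈ S, v j := sum_nonneg fun j _ => hv j
  cases c with
  | none => simp only [choiceProb]; positivity
  | some i =>
    simp only [choiceProb]
    split_ifs
    · have := hv i
      positivity
    · exact le_rfl

theorem sum_choiceProb {v : Fin N → ℝ} (hv : ∀ i, 0 ≤ v i) (S : Assortment N) :
    ∑ c, choiceProb v S c = 1 := by
  have hS : 0 ≤ ∑ j ∈ S, v j := sum_nonneg fun j _ => hv j
  rw [Fintype.sum_option]
  simp only [choiceProb]
  rw [← sum_filter, ← sum_div]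
  simp only [filter_mem_eq_inter, univ_inter]
  rw [← add_div]
  exact div_self (by positivity)

theorem choiceProb_congr {v w : Fin N → ℝ} {S : Assortment N} (h : ∀ i ∈ S, v i = w i)
    (c : Option (Fin N)) : choiceProb v S c = choiceProb w S c := by
  have hS : ∑ j ∈ S, v j = ∑ j ∈ S, w j := sum_congr rfl h
  cases c with
  | none => simp only [choiceProb, hS]
  | some i =>
    simp only [choiceProb, hS]
    split_ifs with hi
    · rw [h i hi]
    · rfl

theorem choiceProb_singleton_none (v : Fin N → ℝ) (k : Fin N) :
    choiceProb v {k} none = 1 / (1 + v k) := by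
  simp [choiceProb]

theorem choiceProb_singleton_some (v : Fin N → ℝ) (k i : Fin N) :
    choiceProb v {k} (some i) = if i = k then v i / (1 + v k) else 0 := by
  simp [choiceProb]

theorem choiceProb_pos_of_ne_zero {v w : Fin N → ℝ} (hw : ∀ i, 0 < w i)
    {S : Assortment N} {c : Option (Fin N)} (h : choiceProb v S c ≠ 0) :
    0 < choiceProb w S c := by
  have hS : 0 ≤ ∑ j ∈ S, w j := sum_nonneg fun j _ => (hw j).le
  cases c with
  | none => simp only [choiceProb]; positivity
  | some i =>
    simp only [choiceProb] at h ⊢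
    split_ifs at h ⊢ with hi
    · have := hw i
      positivity
    · exact absurd rfl h

/-! ### The law of histories and its expectations. -/

theorem sum_toReal_pmf {α : Type*} [Fintype α] (p : PMF α) : ∑ a, (p a).toReal = 1 := by
  have h := p.tsum_coe
  rw [tsum_fintype] at h
  rw [← ENNReal.toReal_sum fun a _ => p.apply_ne_top a, h, ENNReal.toReal_one]

theorem historyProb_nonneg (π : Policy N K) {v : Fin N → ℝ} (hv : ∀ i, 0 ≤ v i)
    (h : History N T) : 0 ≤ historyProb π v h :=
  prod_nonneg fun _ _ => mul_nonneg ENNReal.toReal_nonneg (choiceProb_nonneg hv _ _)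

theorem mem_capped_of_historyProb_ne_zero {π : Policy N K} {v : Fin N → ℝ} {h : History N T}
    (hh : historyProb π v h ≠ 0) (t : Fin T) : (h t).1 ∈ capped N K := by
  refine π.feasible t (h.before t) _ ?_
  rw [PMF.mem_support_iff]
  intro h0
  refine hh (prod_eq_zero (mem_univ t) ?_)
  rw [h0]
  simp

/-- The policy factors do not involve the attractions, and an item never offered does not enter the
choice factors. -/
theorem historyProb_congr (π : Policy N K) {v w : Fin N → ℝ} {h : History N T}
    (hvw : ∀ t, ∀ i ∈ (h t).1, v i = w i) : historyProb π v h = historyProb π w h :=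
  prod_congr rfl fun t _ => by rw [choiceProb_congr (hvw t)]

theorem historyProb_snoc (π : Policy N K) (v : Fin N → ℝ) (h : History N T) (x : Round N) :
    historyProb π v (Fin.snoc (α := fun _ => Round N) h x : History N (T + 1)) =
      historyProb π v h * ((π.rule T h x.1).toReal * choiceProb v x.1 x.2) := by
  unfold historyProb
  rw [Fin.prod_univ_castSucc]
  congr 1
  · refine prod_congr rfl fun t _ => ?_
    have : History.before (Fin.snoc (α := fun _ => Round N) h x : History N (T + 1))
        t.castSucc = h.before t := by
      funext i
      exact Fin.snoc_castSucc (α := fun _ => Round N) x h (Fin.castLE t.isLt.le i)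
    rw [this]
    simp
  · have : History.before (Fin.snoc (α := fun _ => Round N) h x : History N (T + 1))
        (Fin.last T) = h := by
      funext i
      exact Fin.snoc_castSucc (α := fun _ => Round N) x h i
    rw [this]
    simp

theorem expect_succ (π : Policy N K) (v : Fin N → ℝ) (X : History N (T + 1) → ℝ) :
    expect π v X = expect π v fun h : History N T =>
      ∑ S, (π.rule T h S).toReal *
        ∑ c, choiceProb v S c * X (Fin.snoc (α := fun _ => Round N) h (S, c)) := by
  unfold expect
  rw [← (Fin.snocEquiv fun _ : Fin (T + 1) => Round N).sum_comp, Fintype.sum_prod_type,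
    sum_comm]
  refine sum_congr rfl fun h _ => ?_
  rw [Fintype.sum_prod_type, mul_sum]
  refine sum_congr rfl fun S _ => ?_
  rw [mul_sum, mul_sum]
  refine sum_congr rfl fun c _ => ?_
  have := historyProb_snoc π v h (S, c)
  change historyProb π v (Fin.snoc (α := fun _ => Round N) h (S, c) : History N (T + 1)) *
    X (Fin.snoc (α := fun _ => Round N) h (S, c)) = _
  rw [this]
  ring

theorem expect_sub (π : Policy N K) (v : Fin N → ℝ) (X Y : History N T → ℝ) :
    expect π v (fun h => X h - Y h) = expect π v X - expect π v Y := by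
  simp only [expect, mul_sub, sum_sub_distrib]

theorem expect_const_mul (π : Policy N K) (v : Fin N → ℝ) (a : ℝ) (X : History N T → ℝ) :
    expect π v (fun h => a * X h) = a * expect π v X := by
  simp only [expect, mul_sum]
  exact sum_congr rfl fun h _ => by ring

theorem sum_historyProb (π : Policy N K) {v : Fin N → ℝ} (hv : ∀ i, 0 ≤ v i) :
    ∑ h : History N T, historyProb π v h = 1 := by
  have key : expect π v (fun _ : History N T => 1) = 1 := by
    induction T with
    | zero => simp [expect, historyProb]
    | succ T ih =>
      rw [expect_succ]
      simpa only [mul_one, sum_choiceProb hv, sum_toReal_pmf] using ih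
  simpa [expect] using key

theorem expect_const (π : Policy N K) {v : Fin N → ℝ} (hv : ∀ i, 0 ≤ v i) (a : ℝ) :
    expect π v (fun _ : History N T => a) = a := by
  rw [expect, ← sum_mul, sum_historyProb π hv, one_mul]

theorem expect_mono (π : Policy N K) {v : Fin N → ℝ} (hv : ∀ i, 0 ≤ v i)
    {X Y : History N T → ℝ} (hXY : ∀ h, (∀ t, (h t).1 ∈ capped N K) → X h ≤ Y h) :
    expect π v X ≤ expect π v Y := by
  refine sum_le_sum fun h _ => ?_
  by_cases h0 : historyProb π v h = 0
  · simp [h0]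
  · exact mul_le_mul_of_nonneg_left (hXY h (mem_capped_of_historyProb_ne_zero h0))
      (historyProb_nonneg π hv h)

/-- A function of the rounds that is centred given the assortment has total expectation zero. -/
theorem expect_sum_eq_zero (π : Policy N K) {v : Fin N → ℝ} (hv : ∀ i, 0 ≤ v i)
    {ψ : Round N → ℝ} (hψ : ∀ S, ∑ c, choiceProb v S c * ψ (S, c) = 0) :
    expect π v (fun h : History N T => ∑ t, ψ (h t)) = 0 := by
  induction T with
  | zero => simp [expect]
  | succ T ih =>
    rw [expect_succ, ← ih]
    congr 1
    funext h
    simp only [Fin.sum_univ_castSucc, Fin.snoc_castSucc, Fin.snoc_last, mul_add,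
      sum_add_distrib, hψ, ← sum_mul, sum_choiceProb hv, one_mul, add_zero, sum_toReal_pmf]

/-- Replaces each round by its conditional mean given the assortment; applied to `logRatio`, this is
the chain rule for the divergence. -/
theorem expect_sum_round (π : Policy N K) {v : Fin N → ℝ} (hv : ∀ i, 0 ≤ v i)
    (ψ : Round N → ℝ) :
    expect π v (fun h : History N T => ∑ t, ψ (h t)) =
      expect π v (fun h : History N T => ∑ t, ∑ c, choiceProb v (h t).1 c * ψ ((h t).1, c)) := by
  rw [← sub_eq_zero, ← expect_sub]
  simp only [← sum_sub_distrib]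
  refine expect_sum_eq_zero (ψ := fun x => ψ x - ∑ c, choiceProb v x.1 c * ψ (x.1, c))
    π hv fun S => ?_
  simp only [mul_sub, sum_sub_distrib, ← sum_mul, sum_choiceProb hv, one_mul, sub_self]

/-! ### Likelihood ratios and overlap of two laws. -/

/-- The log-likelihood ratio of one round. -/
noncomputable def logRatio (v w : Fin N → ℝ) (x : Round N) : ℝ :=
  Real.log (choiceProb v x.1 x.2 / choiceProb w x.1 x.2)

/-- The policy factors are the same under both instances and cancel. -/
theorem log_historyProb_div (π : Policy N K) {v w : Fin N → ℝ}
    (hw : ∀ i, 0 < w i) {h : History N T} (hh : historyProb π v h ≠ 0) :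
    0 < historyProb π w h ∧
      Real.log (historyProb π v h / historyProb π w h) = ∑ t, logRatio v w (h t) := by
  have hne := prod_ne_zero_iff.mp hh
  have hrule : ∀ t : Fin T, (π.rule t (h.before t) (h t).1).toReal ≠ 0 := fun t =>
    left_ne_zero_of_mul (hne t (mem_univ t))
  have hcv : ∀ t : Fin T, choiceProb v (h t).1 (h t).2 ≠ 0 := fun t =>
    right_ne_zero_of_mul (hne t (mem_univ t))
  have hcw : ∀ t : Fin T, 0 < choiceProb w (h t).1 (h t).2 := fun t =>
    choiceProb_pos_of_ne_zero hw (hcv t)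
  refine ⟨prod_pos fun t _ =>
    mul_pos (lt_of_le_of_ne ENNReal.toReal_nonneg (hrule t).symm) (hcw t), ?_⟩
  unfold historyProb logRatio
  rw [← prod_div_distrib, Real.log_prod]
  · refine sum_congr rfl fun t _ => ?_
    rw [mul_div_mul_left _ _ (hrule t)]
  · intro t _
    exact div_ne_zero (mul_ne_zero (hrule t) (hcv t)) (mul_ne_zero (hrule t) (hcw t).ne')

/-- Pointwise form of the two-point bound: `log x ≤ x - 1` at `x = √q / √p` bounds `√p * √q` from
below, and AM-GM passes to the minimum. Summed over histories it gives `1/2 - KL/4 - 1/8`. -/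
theorem min_ge_of_log_div {p q : ℝ} (hp : 0 < p) (hq : 0 < q) :
    p / 2 * (1 - Real.log (p / q) / 2) - (p + q) / 16 ≤ min p q := by
  have hsq : p * (1 - Real.log (p / q) / 2) ≤ √p * √q := by
    have h1 : Real.log (√q / √p) ≤ √q / √p - 1 :=
      Real.log_le_sub_one_of_pos (div_pos (Real.sqrt_pos.2 hq) (Real.sqrt_pos.2 hp))
    have h2 : Real.log (√q / √p) = -(Real.log (p / q) / 2) := by
      rw [Real.log_div (Real.sqrt_pos.2 hq).ne' (Real.sqrt_pos.2 hp).ne', Real.log_sqrt hq.le,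
        Real.log_sqrt hp.le, Real.log_div hp.ne' hq.ne']
      ring
    have h3 : p * (√q / √p) = √p * √q := by
      have := Real.sqrt_pos.2 hp
      field_simp
      rw [Real.sq_sqrt hp.le]
    nlinarith
  have hP := Real.sq_sqrt hp.le
  have hQ := Real.sq_sqrt hq.le
  rcases le_total p q with h | h
  · rw [min_eq_left h]
    nlinarith [sq_nonneg (√p - √q / 4)]
  · rw [min_eq_right h]
    nlinarith [sq_nonneg (√q - √p / 4)]

/-- Two-point bound: laws at small Kullback-Leibler divergence overlap. -/
theorem sum_min_historyProb (π : Policy N K) {v w : Fin N → ℝ} (hv : ∀ i, 0 < v i)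
    (hw : ∀ i, 0 < w i)
    (hkl : expect π v (fun h : History N T => ∑ t, logRatio v w (h t)) ≤ 1) :
    1 / 8 ≤ ∑ h : History N T, min (historyProb π v h) (historyProb π w h) := by
  have hpt : ∀ h : History N T,
      historyProb π v h / 2 - historyProb π v h * (∑ t, logRatio v w (h t)) / 4
        - (historyProb π v h + historyProb π w h) / 16
        ≤ min (historyProb π v h) (historyProb π w h) := by
    intro h
    have hp := historyProb_nonneg π (fun i => (hv i).le) h
    have hq := historyProb_nonneg π (fun i => (hw i).le) h
    by_cases h0 : historyProb π v h = 0
    · rw [h0, min_eq_left hq]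
      linarith
    · obtain ⟨hq', hlog⟩ := log_historyProb_div π hw h0
      rw [← hlog]
      have := min_ge_of_log_div (lt_of_le_of_ne hp (Ne.symm h0)) hq'
      linarith
  have := sum_le_sum fun h (_ : h ∈ univ) => hpt h
  rw [sum_sub_distrib, sum_sub_distrib, ← sum_div, ← sum_div, ← sum_div, sum_add_distrib,
    sum_historyProb π fun i => (hv i).le, sum_historyProb π fun i => (hw i).le] at this
  unfold expect at hkl
  linarith

/-! ### Offers of one item: information and cost. -/

/-- The number of periods in which item `k` is offered. -/
noncomputable def offers (k : Fin N) (h : History N T) : ℝ :=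
  ∑ t, if k ∈ (h t).1 then 1 else 0

theorem eq_singleton_of_mem_capped_one {S : Assortment N} (hS : S ∈ capped N 1) {k : Fin N}
    (hk : k ∈ S) : S = {k} := by
  have hcard : S.card ≤ 1 := by simpa [capped] using hS
  exact eq_singleton_iff_unique_mem.mpr ⟨hk, fun x hx => card_le_one.mp hcard x hx k hk⟩

theorem logRatio_of_agree {v w : Fin N → ℝ} {S : Assortment N} (h : ∀ i ∈ S, v i = w i)
    (c : Option (Fin N)) : logRatio v w (S, c) = 0 := by
  simp only [logRatio, choiceProb_congr h c]
  by_cases h0 : choiceProb w S c = 0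
  -- Here the ratio is `0 / 0 = 0`, and `Real.log 0 = 0`.
  · simp [h0]
  · simp [div_self h0]

/-- The bound `log x ≤ x - 1` dominates the divergence by the chi-square divergence, computed
exactly. -/
theorem sum_logRatio_singleton_le {v w : Fin N → ℝ} (hv : ∀ i, 0 < v i) (hw : ∀ i, 0 < w i)
    (k : Fin N) :
    ∑ c, choiceProb v {k} c * logRatio v w ({k}, c) ≤ (v k - w k) ^ 2 / w k := by
  have hvk := hv k
  have hwk := hw k
  rw [Fintype.sum_option, Fintype.sum_eq_single k]
  · simp only [logRatio, choiceProb_singleton_none, choiceProb_singleton_some, if_true]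
    have h1 := Real.log_le_sub_one_of_pos
      (show 0 < 1 / (1 + v k) / (1 / (1 + w k)) by positivity)
    have h2 := Real.log_le_sub_one_of_pos
      (show 0 < v k / (1 + v k) / (w k / (1 + w k)) by positivity)
    calc _ ≤ 1 / (1 + v k) * (1 / (1 + v k) / (1 / (1 + w k)) - 1)
          + v k / (1 + v k) * (v k / (1 + v k) / (w k / (1 + w k)) - 1) := by gcongr
      _ = (v k - w k) ^ 2 / w k / (1 + v k) ^ 2 := by field_simp; ring
      _ ≤ (v k - w k) ^ 2 / w k := div_le_self (by positivity) (by nlinarith)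
  · intro i hi
    simp [choiceProb_singleton_some, hi]

/-- Only rounds offering `k` carry information. The offers are counted under `v` alone, whence the
later choice of a near-minimiser. -/
theorem expect_logRatio_le (π : Policy N 1) {v w : Fin N → ℝ} (hv : ∀ i, 0 < v i)
    (hw : ∀ i, 0 < w i) {k : Fin N} (hvw : ∀ i, i ≠ k → v i = w i) :
    expect π v (fun h : History N T => ∑ t, logRatio v w (h t)) ≤
      (v k - w k) ^ 2 / w k * expect π v (offers k : History N T → ℝ) := by
  rw [expect_sum_round π fun i => (hv i).le, ← expect_const_mul]
  refine expect_mono π (fun i => (hv i).le) fun h hh => ?_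
  rw [offers, mul_sum]
  refine sum_le_sum fun t _ => ?_
  split_ifs with hk
  · rw [eq_singleton_of_mem_capped_one (hh t) hk, mul_one]
    exact sum_logRatio_singleton_le hv hw k
  · rw [mul_zero]
    refine (sum_eq_zero fun c _ => ?_).le
    rw [logRatio_of_agree (fun i hi => hvw i fun e => hk (e ▸ hi)), mul_zero]

theorem regret_eq (r : Fin N → ℝ) (π : Policy N K) {v : Fin N → ℝ} (hv : ∀ i, 0 ≤ v i) :
    regret r T π v =
      expect π v (fun h : History N T => ∑ t, (optRevenue K r v - revenue r v (h t).1)) := by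
  simp only [sum_sub_distrib]
  rw [expect_sub, expect_const π hv]
  rfl

theorem revenue_le_optRevenue (r v : Fin N → ℝ) {S : Assortment N} (hS : S ∈ capped N K) :
    revenue r v S ≤ optRevenue K r v :=
  le_sup' (revenue r v) hS

theorem revenue_singleton (r v : Fin N → ℝ) (k : Fin N) :
    revenue r v {k} = r k * v k / (1 + v k) := by
  simp [revenue]

theorem singleton_mem_capped (k : Fin N) : ({k} : Assortment N) ∈ capped N 1 := by
  simp [capped]

theorem mul_expect_offers_le_regret (r : Fin N → ℝ) (π : Policy N 1) {v : Fin N → ℝ}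
    (hv : ∀ i, 0 ≤ v i) {i k : Fin N} {g : ℝ} (hg : g ≤ revenue r v {i} - revenue r v {k}) :
    g * expect π v (offers k : History N T → ℝ) ≤ regret r T π v := by
  rw [regret_eq r π hv, ← expect_const_mul]
  refine expect_mono π hv fun h hh => ?_
  rw [offers, mul_sum]
  refine sum_le_sum fun t _ => ?_
  split_ifs with hk
  · rw [eq_singleton_of_mem_capped_one (hh t) hk]
    linarith [revenue_le_optRevenue r v (singleton_mem_capped i)]
  · linarith [revenue_le_optRevenue r v (hh t)]

/-! ### Two-point estimation error and the one-parameter family of instances. -/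

/-- Overlap of two laws forces a large error on one of the two instances. -/
theorem le_estError_add_estError {K T : ℕ} (π : Policy 2 K) (est : Estimator 2 T)
    {v w : Fin 2 → ℝ} {m : History 2 T → ℝ} (hm : ∀ h, 0 ≤ m h)
    (hmv : ∀ h, m h ≤ historyProb π v h) (hmw : ∀ h, m h ≤ historyProb π w h) :
    |(v 0 - v 1) - (w 0 - w 1)| * ∑ h, m h ≤ estError π est v + estError π est w := by
  unfold estError expect
  rw [← sum_add_distrib, mul_sum]
  refine sum_le_sum fun h _ => ?_
  have h1 := mul_le_mul_of_nonneg_right (hmv h) (abs_nonneg (est h - (v 0 - v 1)))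
  have h2 := mul_le_mul_of_nonneg_right (hmw h) (abs_nonneg (est h - (w 0 - w 1)))
  have h3 := abs_sub_le (v 0 - v 1) (est h) (w 0 - w 1)
  rw [abs_sub_comm (v 0 - v 1) (est h)] at h3
  nlinarith [mul_le_mul_of_nonneg_left h3 (hm h)]

theorem estError_nonneg {K T : ℕ} (π : Policy 2 K) (est : Estimator 2 T) {v : Fin 2 → ℝ}
    (hv : ∀ i, 0 ≤ v i) : 0 ≤ estError π est v :=
  sum_nonneg fun h _ => mul_nonneg (historyProb_nonneg π hv h) (abs_nonneg _)

/-- The instance in which item `k` has attraction `b` and every other item has attraction `1/2`. -/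
noncomputable def pointInstance (k : Fin N) (b : ℝ) : Fin N → ℝ :=
  Function.update (fun _ => 1 / 2) k b

@[simp]
theorem pointInstance_self (k : Fin N) (b : ℝ) : pointInstance k b k = b := by
  simp [pointInstance]

theorem pointInstance_of_ne {i k : Fin N} (h : i ≠ k) (b : ℝ) :
    pointInstance k b i = 1 / 2 := by
  simp [pointInstance, h]

theorem pointInstance_pos (k : Fin N) {b : ℝ} (hb : 0 < b) (i : Fin N) :
    0 < pointInstance k b i := by
  by_cases h : i = k
  · simpa [h] using hb
  · norm_num [pointInstance_of_ne h]

theorem abs_pointInstance_sub (k : Fin 2) (b : ℝ) :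
    |pointInstance k b 0 - pointInstance k b 1| = |b - 1 / 2| := by
  fin_cases k
  · simp [pointInstance]
  · simp [pointInstance, abs_sub_comm]

theorem abs_pointInstance_sub_sub (k : Fin 2) (b b' : ℝ) :
    |(pointInstance k b 0 - pointInstance k b 1) -
      (pointInstance k b' 0 - pointInstance k b' 1)| = |b - b'| := by
  fin_cases k
  · simp [pointInstance]
  · simp [pointInstance, abs_sub_comm]

theorem pointInstance_mem_instances (k : Fin 2) {δ b : ℝ} (hb : 0 < b) (hb1 : b ≤ 1)
    (hδ : δ ≤ |b - 1 / 2|) : pointInstance k b ∈ instances δ := by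
  refine ⟨fun i => ⟨pointInstance_pos k hb i, ?_⟩, by rwa [abs_pointInstance_sub]⟩
  by_cases h : i = k
  · simpa [h] using hb1
  · norm_num [pointInstance_of_ne h]

/-! ### The case of rare offers. -/

/-- If item `k` is unlikely to be offered at some instance, then its attraction cannot be learnt
at the instances where it is the best item, and the regret there is bounded below. -/
theorem lower_bound_of_rare_offers {r : Fin 2 → ℝ} (hr : ∀ i, 0 < r i) {δ : ℝ} (hδ : 0 < δ)
    (hδ' : δ < 1 / 2) {i k : Fin 2} (hik : i ≠ k) (hrik : r i ≤ r k) {T : ℕ} (hT : 1 ≤ T)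
    (π : Policy 2 1) (est : Estimator 2 T) {b : ℝ} (hb : 0 < b)
    (hoff : expect π (pointInstance k b) (offers k : History 2 T → ℝ) ≤ 1 / 2) :
    ∃ v ∈ instances δ,
      (1 / 2 - δ) / 4 * √(r k * δ / 6) ≤ estError π est v * √(regret r T π v) := by
  classical
  -- The part of the law on which `k` is never offered: it lies below the law of every
  -- `pointInstance k b'`, and by Markov's inequality has mass at least 1/2.
  set m : History 2 T → ℝ := fun h =>
    historyProb π (pointInstance k b) h * if ∀ t, k ∉ (h t).1 then 1 else 0 with hmdef
  have hb0 : ∀ j, 0 ≤ pointInstance k b j := fun j => (pointInstance_pos k hb j).le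
  have hm0 : ∀ h, 0 ≤ m h := fun h =>
    mul_nonneg (historyProb_nonneg π hb0 h) (by split_ifs <;> norm_num)
  have hmle : ∀ b', 0 < b' → ∀ h, m h ≤ historyProb π (pointInstance k b') h := by
    intro b' hb' h
    simp only [hmdef]
    split_ifs with hk
    · rw [mul_one]
      refine (historyProb_congr π fun t j hj => ?_).le
      have hjk : j ≠ k := fun e => hk t (e ▸ hj)
      rw [pointInstance_of_ne hjk, pointInstance_of_ne hjk]
    · rw [mul_zero]
      exact historyProb_nonneg π (fun j => (pointInstance_pos k hb' j).le) h
  have hmsum : 1 / 2 ≤ ∑ h, m h := by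
    have : expect π (pointInstance k b) (fun h : History 2 T => 1 - offers k h) ≤ ∑ h, m h := by
      refine expect_mono π hb0 fun h _ => ?_
      split_ifs with hk
      · have : 0 ≤ offers k h := sum_nonneg fun t _ => by split_ifs <;> norm_num
        linarith
      · push Not at hk
        obtain ⟨t, ht⟩ := hk
        have : (if k ∈ (h t).1 then (1 : ℝ) else 0) ≤ offers k h :=
          single_le_sum (f := fun t => if k ∈ (h t).1 then (1 : ℝ) else 0)
            (fun t _ => by split_ifs <;> norm_num) (mem_univ t)
        rw [if_pos ht] at this
        linarith
    rw [expect_sub, expect_const π hb0] at this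
    linarith
  have hreg : ∀ b', 1 / 2 + δ ≤ b' → b' ≤ 1 →
      r k * δ / 6 ≤ regret r T π (pointInstance k b') := by
    intro b' hb' hb1
    have hb'0 : 0 < b' := by linarith
    have hv0 : ∀ j, 0 ≤ pointInstance k b' j := fun j => (pointInstance_pos k hb'0 j).le
    -- At `b' = 1/2 + δ` this amounts to `δ ≤ 1/2`. Without `k` the revenue is at most `r k / 3`, so
    -- the gap is at least `r k * δ / 3`.
    have hfrac : 1 / 3 + δ / 3 ≤ b' / (1 + b') := by
      rw [le_div_iff₀ (by linarith)]
      nlinarith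
    have hopt : r k * (1 / 3 + δ / 3) ≤ optRevenue 1 r (pointInstance k b') := by
      refine le_trans ?_ (revenue_le_optRevenue r _ (singleton_mem_capped k))
      rw [revenue_singleton, pointInstance_self, mul_div_assoc]
      exact mul_le_mul_of_nonneg_left hfrac (hr k).le
    have hrev : ∀ S ∈ capped 2 1, k ∉ S → revenue r (pointInstance k b') S ≤ r k / 3 := by
      intro S hS hk
      by_cases hi : i ∈ S
      · rw [eq_singleton_of_mem_capped_one hS hi, revenue_singleton, pointInstance_of_ne hik]
        norm_num
        linarith
      · have : S = ∅ := by
          refine eq_empty_of_forall_notMem fun j hj => ?_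
          have : j = i ∨ j = k := by omega
          rcases this with rfl | rfl
          · exact hi hj
          · exact hk hj
        rw [this]
        simpa [revenue] using (div_pos (hr k) three_pos).le
    rw [regret_eq r π hv0]
    have hgap : 0 ≤ r k * δ / 3 := by
      have := hr k
      positivity
    calc r k * δ / 6 ≤ r k * δ / 3 * ∑ h, m h := by nlinarith
      _ = ∑ h, m h * (r k * δ / 3) := by rw [← sum_mul, mul_comm]
      _ ≤ _ := sum_le_sum fun h _ => ?_
    by_cases h0 : historyProb π (pointInstance k b') h = 0
    · have : m h = 0 := le_antisymm (h0 ▸ hmle b' hb'0 h) (hm0 h)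
      rw [this, h0]
      simp
    have hcap := mem_capped_of_historyProb_ne_zero h0
    have hnn : ∀ t, 0 ≤ optRevenue 1 r (pointInstance k b') -
        revenue r (pointInstance k b') (h t).1 := fun t =>
      sub_nonneg.mpr (revenue_le_optRevenue r _ (hcap t))
    by_cases hk : ∀ t, k ∉ (h t).1
    · refine mul_le_mul (hmle b' hb'0 h) ?_ hgap (historyProb_nonneg π hv0 h)
      -- The loss of one period suffices; `hT` provides it.
      refine le_trans ?_ (single_le_sum (fun t _ => hnn t) (mem_univ ⟨0, hT⟩))
      linarith [hrev _ (hcap ⟨0, hT⟩) (hk _)]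
    · have : m h = 0 := by simp only [hmdef, if_neg hk, mul_zero]
      rw [this, zero_mul]
      exact mul_nonneg (historyProb_nonneg π hv0 h) (sum_nonneg fun t _ => hnn t)
  have hx : (0 : ℝ) < 1 / 2 + δ := by linarith
  have herr := le_estError_add_estError π est hm0 (hmle (1 / 2 + δ) hx) (hmle 1 one_pos)
  rw [abs_pointInstance_sub_sub, abs_sub_comm, abs_of_pos (by linarith)] at herr
  have hsplit : (1 / 2 - δ) / 4 ≤ estError π est (pointInstance k (1 / 2 + δ)) ∨
      (1 / 2 - δ) / 4 ≤ estError π est (pointInstance k 1) := by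
    by_contra! hcon
    nlinarith [mul_le_mul_of_nonneg_left hmsum (show 0 ≤ 1 - (1 / 2 + δ) by linarith)]
  rcases hsplit with h | h
  · refine ⟨_, pointInstance_mem_instances k hx (by linarith) ?_, ?_⟩
    · rw [abs_of_pos] <;> linarith
    · exact mul_le_mul h (Real.sqrt_le_sqrt (hreg _ le_rfl (by linarith)))
        (Real.sqrt_nonneg _) (estError_nonneg π est fun j => (pointInstance_pos k hx j).le)
  · refine ⟨_, pointInstance_mem_instances k one_pos le_rfl ?_, ?_⟩
    · rw [abs_of_pos] <;> linarith
    · exact mul_le_mul h (Real.sqrt_le_sqrt (hreg _ (by linarith) le_rfl))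
        (Real.sqrt_nonneg _) (estError_nonneg π est fun j => (pointInstance_pos k one_pos j).le)

/-! ### The case of frequent offers. -/

/-- The positive lower bound makes the infimum smaller than its double, so no continuity of `f` or
attained minimum is needed. -/
theorem exists_le_two_mul {s : Set ℝ} (hs : s.Nonempty) {f : ℝ → ℝ} {a : ℝ} (ha : 0 < a)
    (hf : ∀ x ∈ s, a ≤ f x) : ∃ x ∈ s, ∀ y ∈ s, f x ≤ 2 * f y := by
  have hbdd : BddBelow (f '' s) := ⟨a, by rintro _ ⟨x, hx, rfl⟩; exact hf x hx⟩
  have hinf : a ≤ sInf (f '' s) :=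
    le_csInf (hs.image f) (by rintro _ ⟨x, hx, rfl⟩; exact hf x hx)
  obtain ⟨_, ⟨x, hx, rfl⟩, hlt⟩ :=
    exists_lt_of_csInf_lt (hs.image f) (show sInf (f '' s) < 2 * sInf (f '' s) by linarith)
  refine ⟨x, hx, fun y hy => ?_⟩
  linarith [csInf_le hbdd (Set.mem_image_of_mem f hy)]

/-- If item `k` is offered often at all instances of an interval where it is not the best item,
a two-point argument at a nearly minimal number of offers bounds the product from below. -/
theorem lower_bound_of_frequent_offers {r : Fin 2 → ℝ} (hr : ∀ i, 0 < r i) {δ : ℝ}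
    {i k : Fin 2} (hik : i ≠ k) {β : ℝ} (hβ : 0 < β) (hβ1 : β ≤ 1)
    (hβδ : β ≤ 1 / 2 - δ) (hβr : r k * β ≤ r i / 6) {T : ℕ} (π : Policy 2 1)
    (est : Estimator 2 T)
    (hoff : ∀ b ∈ Set.Icc (β / 2) β,
      1 / 2 ≤ expect π (pointInstance k b) (offers k : History 2 T → ℝ)) :
    ∃ v ∈ instances δ, β / 128 * √(r i / 12) ≤ estError π est v * √(regret r T π v) := by
  set f : ℝ → ℝ := fun b => expect π (pointInstance k b) (offers k : History 2 T → ℝ) with hf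
  obtain ⟨b, hb, hmin⟩ := exists_le_two_mul (Set.nonempty_Icc.mpr (by linarith)) (by norm_num) hoff
  change ∀ y ∈ _, f b ≤ 2 * f y at hmin
  have hfb : 1 / 2 ≤ f b := hoff b hb
  have hfb0 : 0 < f b := by linarith
  set s := √(f b) with hs
  have hs2 : s ^ 2 = f b := Real.sq_sqrt hfb0.le
  have hs0 : 0 < s := Real.sqrt_pos.2 hfb0
  have hs1 : 1 / 2 ≤ s := by
    rw [hs]
    exact Real.le_sqrt_of_sq_le (by linarith)
  have hεle : β / 8 / s ≤ β / 4 := by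
    rw [div_le_iff₀ hs0]
    nlinarith
  have hεpos : 0 < β / 8 / s := by positivity
  -- The step is at most half the length of the interval, so moving away from the nearer endpoint
  -- stays inside.
  obtain ⟨b', hb', hbb'⟩ : ∃ b' ∈ Set.Icc (β / 2) β, |b - b'| = β / 8 / s := by
    by_cases hmid : b ≤ 3 / 4 * β
    · refine ⟨b + β / 8 / s, ⟨by linarith [hb.1], by linarith⟩, ?_⟩
      rw [sub_add_cancel_left, abs_neg, abs_of_pos hεpos]
    · refine ⟨b - β / 8 / s, ⟨by linarith, by linarith [hb.2]⟩, ?_⟩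
      rw [sub_sub_cancel, abs_of_pos hεpos]
  have hpos : ∀ x ∈ Set.Icc (β / 2) β, 0 < x := fun x hx => by linarith [hx.1]
  have hreg : ∀ x ∈ Set.Icc (β / 2) β,
      r i / 12 * f b ≤ regret r T π (pointInstance k x) := by
    intro x hx
    have hgap : r i / 6 ≤
        revenue r (pointInstance k x) {i} - revenue r (pointInstance k x) {k} := by
      rw [revenue_singleton, revenue_singleton, pointInstance_self, pointInstance_of_ne hik]
      have hx0 := hpos x hx
      have h1 : r k * x / (1 + x) ≤ r k * x :=
        div_le_self (mul_nonneg (hr k).le hx0.le) (by linarith)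
      have h2 : r k * x ≤ r k * β := mul_le_mul_of_nonneg_left hx.2 (hr k).le
      have h3 : r i * (1 / 2) / (1 + 1 / 2) = r i / 3 := by ring
      linarith
    refine le_trans ?_ (mul_expect_offers_le_regret r π
      (fun j => (pointInstance_pos k (hpos x hx) j).le) hgap)
    have := hmin x hx
    have hri := hr i
    change _ ≤ r i / 6 * f x
    nlinarith
  have hkl : expect π (pointInstance k b)
      (fun h : History 2 T => ∑ t, logRatio (pointInstance k b) (pointInstance k b') (h t)) ≤ 1 := by
    refine (expect_logRatio_le π (pointInstance_pos k (hpos b hb))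
      (pointInstance_pos k (hpos b' hb')) fun j hj => by
        rw [pointInstance_of_ne hj, pointInstance_of_ne hj]).trans ?_
    rw [pointInstance_self, pointInstance_self, ← sq_abs, hbb']
    change _ * f b ≤ 1
    rw [← hs2]
    -- The offers cancel; as `b' ≥ β/2`, what remains is at most `β / 32`.
    have : (β / 8 / s) ^ 2 / b' * s ^ 2 = β ^ 2 / 64 / b' := by
      field_simp
      norm_num
    rw [this, div_le_iff₀ (hpos b' hb')]
    nlinarith [hb'.1]
  have hover := sum_min_historyProb π (pointInstance_pos k (hpos b hb))
    (pointInstance_pos k (hpos b' hb')) hkl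
  have herr := le_estError_add_estError π est
    (v := pointInstance k b) (w := pointInstance k b')
    (fun h => le_min
      (historyProb_nonneg π (fun j => (pointInstance_pos k (hpos b hb) j).le) h)
      (historyProb_nonneg π (fun j => (pointInstance_pos k (hpos b' hb') j).le) h))
    (fun h => min_le_left _ _) (fun h => min_le_right _ _)
  rw [abs_pointInstance_sub_sub, hbb'] at herr
  have hlow := mul_le_mul_of_nonneg_left hover hεpos.le
  have hfinal : ∀ x ∈ Set.Icc (β / 2) β, β / 8 / s / 16 ≤ estError π est (pointInstance k x) →
      ∃ v ∈ instances δ, β / 128 * √(r i / 12) ≤ estError π est v * √(regret r T π v) := by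
    intro x hx hex
    refine ⟨_, pointInstance_mem_instances k (hpos x hx) (hx.2.trans hβ1) ?_, ?_⟩
    · rw [abs_sub_comm]
      exact (by linarith [hx.2] : δ ≤ 1 / 2 - x).trans (le_abs_self _)
    · calc β / 128 * √(r i / 12) = β / 8 / s / 16 * √(r i / 12 * f b) := by
            rw [Real.sqrt_mul (by linarith [hr i]), ← hs]
            generalize √(r i / 12) = u
            field_simp
            ring
        _ ≤ _ := mul_le_mul hex (Real.sqrt_le_sqrt (hreg x hx)) (Real.sqrt_nonneg _)
            (estError_nonneg π est fun j => (pointInstance_pos k (hpos x hx) j).le)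
  by_cases he : β / 8 / s / 16 ≤ estError π est (pointInstance k b)
  · exact hfinal b hb he
  · exact hfinal b' hb' (by linarith)

/-! ### Combination of the two cases. -/

theorem exists_lower_bound {r : Fin 2 → ℝ} (hr : ∀ i, 0 < r i) {δ : ℝ} (hδ : 0 < δ)
    (hδ' : δ < 1 / 2) {i k : Fin 2} (hik : i ≠ k) (hrik : r i ≤ r k) :
    ∃ c : ℝ, 0 < c ∧ ∀ T : ℕ, 1 ≤ T → ∀ (π : Policy 2 1) (est : Estimator 2 T),
      ∃ v ∈ instances δ, c ≤ estError π est v * √(regret r T π v) := by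
  have hri := hr i
  have hrk := hr k
  have hδ0 : 0 < 1 / 2 - δ := by linarith
  -- The first bound keeps `b` at distance `δ` below 1/2; the second keeps the revenue of `k` below
  -- `r i / 6`, half of the revenue `r i / 3` of item `i`.
  set β := min (1 / 2 - δ) (r i / (6 * r k)) with hβdef
  have hβ : 0 < β := lt_min hδ0 (by positivity)
  have hβδ : β ≤ 1 / 2 - δ := min_le_left _ _
  have hβr : r k * β ≤ r i / 6 := by
    calc r k * β ≤ r k * (r i / (6 * r k)) :=
          mul_le_mul_of_nonneg_left (min_le_right _ _) hrk.le
      _ = r i / 6 := by field_simp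
  refine ⟨min ((1 / 2 - δ) / 4 * √(r k * δ / 6)) (β / 128 * √(r i / 12)),
    lt_min (by positivity) (by positivity), fun T hT π est => ?_⟩
  by_cases hrare : ∃ b ∈ Set.Icc (β / 2) β,
      expect π (pointInstance k b) (offers k : History 2 T → ℝ) ≤ 1 / 2
  · obtain ⟨b, hb, hoff⟩ := hrare
    obtain ⟨v, hv, hle⟩ := lower_bound_of_rare_offers hr hδ hδ' hik hrik hT π est
      (by linarith [hb.1]) hoff
    exact ⟨v, hv, (min_le_left _ _).trans hle⟩
  · push Not at hrare
    obtain ⟨v, hv, hle⟩ := lower_bound_of_frequent_offers hr hik hβ (by linarith) hβδ hβr π est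
      fun b hb => (hrare b hb).le
    exact ⟨v, hv, (min_le_right _ _).trans hle⟩

end MNL

theorem theorem4p7 (r : Fin 2 → ℝ) (hr : ∀ i, 0 < r i)
    (δ : ℝ) (hδ : 0 < δ) (hδ' : δ < 1 / 2) :
    ∃ c : ℝ, 0 < c ∧
      ∀ T : ℕ, 1 ≤ T →
        ∀ (π : MNL.Policy 2 1) (est : MNL.Estimator 2 T),
          ∃ v ∈ MNL.instances δ,
            c ≤ MNL.estError π est v * Real.sqrt (MNL.regret r T π v) := by
  rcases le_total (r 0) (r 1) with h | h
  · exact MNL.exists_lower_bound hr hδ hδ' (by decide : (0 : Fin 2) ≠ 1) h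
  · exact MNL.exists_lower_bound hr hδ hδ' (by decide : (1 : Fin 2) ≠ 0) h
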